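/- Let $Q$ be a digraph in the following sense: it has a vertex set $V$, no loops, and at most one connection between any two distinct vertices, each connection being either an unoriented edge or an arrow. The Hecke–Kiselman monoid $H_Q$ is the monoid generated by elements $a_i$, $i\in V$, subject to the relations $a_i^2=a_i$ for all $i$; $a_ia_j=a_ja_i$ if $i$ and $j$ are not connected; $a_ia_ja_i=a_ja_ia_j$ if $i$ and $j$ are joined by an edge; and $a_ia_j=a_ia_ja_i=a_ja_ia_j$ if there is an arrow from $i$ to $j$. A Dynkin diagram is a finite graph each of whose connected components is isomorphic to one of $A_n$ ($n\ge 1$), $D_n$ ($n\ge 4$), $E_6$, $E_7$, $E_8$. 1. Let $C$ be a Dynkin diagram and let $Q$ be an oriented graph obtained from $C$ by choosing an orientation of every edge. Then $H_Q$ is finite. 2. Let $Q$ be a digraph such that $H_Q$ is finite, and let $C$ be the graph obtained from $Q$ by removing every arrow (keeping all vertices). Then $C$ is a Dynkin diagram. -/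

import Mathlib

/-- A graph having at most one side between each pair of distinct vertices (and no loops), where
each side is either an unoriented edge or an oriented arrow. -/
structure MixedGraph (V : Type*) where
  /-- the graph formed by the unoriented edges, i.e. what is left after deleting all arrows -/
  edges : SimpleGraph V
  /-- `arrow i j` means that there is an arrow from `i` to `j` -/
  arrow : V → V → Prop
  arrow_asymm : ∀ i j, arrow i j → ¬ arrow j i
  arrow_not_edge : ∀ i j, arrow i j → ¬ edges.Adj i j

namespace MixedGraph

variable {V : Type*} (Q : MixedGraph V)

/-- Two vertices are connected if there is a side (edge, or arrow in either direction)
between them. -/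
def Connects (i j : V) : Prop := Q.edges.Adj i j ∨ Q.arrow i j ∨ Q.arrow j i

/-- The defining relations of the Hecke–Kiselman monoid, on words in the vertices. -/
inductive Rel : FreeMonoid V → FreeMonoid V → Prop
  | idem (i : V) :
      Rel (FreeMonoid.of i * FreeMonoid.of i) (FreeMonoid.of i)
  | comm (i j : V) (h : ¬ Q.Connects i j) :
      Rel (FreeMonoid.of i * FreeMonoid.of j) (FreeMonoid.of j * FreeMonoid.of i)
  | braid (i j : V) (h : Q.edges.Adj i j) :
      Rel (FreeMonoid.of i * FreeMonoid.of j * FreeMonoid.of i)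
        (FreeMonoid.of j * FreeMonoid.of i * FreeMonoid.of j)
  | arrow_left (i j : V) (h : Q.arrow i j) :
      Rel (FreeMonoid.of i * FreeMonoid.of j)
        (FreeMonoid.of i * FreeMonoid.of j * FreeMonoid.of i)
  | arrow_right (i j : V) (h : Q.arrow i j) :
      Rel (FreeMonoid.of i * FreeMonoid.of j)
        (FreeMonoid.of j * FreeMonoid.of i * FreeMonoid.of j)

/-- The Hecke–Kiselman monoid `H_Q`. -/
abbrev HeckeKiselman : Type _ := PresentedMonoid Q.Rel

/-- `Q` is obtained from the graph `C` by choosing an orientation of every edge: it has no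
unoriented edges, and its arrows join exactly the pairs of adjacent vertices of `C`. (By
asymmetry of arrows, each edge of `C` receives exactly one of its two orientations.) -/
def IsOrientationOf (C : SimpleGraph V) : Prop :=
  Q.edges = ⊥ ∧ ∀ i j, C.Adj i j ↔ Q.arrow i j ∨ Q.arrow j i

end MixedGraph

namespace SimpleGraph

/-- The graph on `0, …, n - 1` consisting of the path `0 — 1 — ⋯ — (n - 2)` together with the
vertex `n - 1`, joined to the vertex `k` only. -/
def branchedPath (n k : ℕ) : SimpleGraph (Fin n) :=
  SimpleGraph.fromRel fun i j =>
    ((i : ℕ) + 1 = j ∧ (j : ℕ) + 1 < n) ∨ ((i : ℕ) = k ∧ (j : ℕ) + 1 = n)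

/-- The graph `Aₙ` (meant for `1 ≤ n`): a path with `n` vertices. -/
def graphA (n : ℕ) : SimpleGraph (Fin n) := pathGraph n

/-- The graph `Dₙ` (meant for `4 ≤ n`): the path `0 — ⋯ — (n - 2)` and one more vertex joined
to `n - 3`, the last vertex but one of the path. -/
def graphD (n : ℕ) : SimpleGraph (Fin n) := branchedPath n (n - 3)

/-- The graph `Eₙ` (meant for `n = 6, 7, 8`): the path `0 — ⋯ — (n - 2)` and one more vertex
joined to `2`, the third vertex of the path. -/
def graphE (n : ℕ) : SimpleGraph (Fin n) := branchedPath n 2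

/-- `G` is isomorphic to one of `Aₙ` (`n ≥ 1`), `Dₙ` (`n ≥ 4`), `E₆`, `E₇`, `E₈`. -/
def IsADE {V : Type*} (G : SimpleGraph V) : Prop :=
  (∃ n, 1 ≤ n ∧ Nonempty (G ≃g graphA n)) ∨
  (∃ n, 4 ≤ n ∧ Nonempty (G ≃g graphD n)) ∨
  (∃ n, (n = 6 ∨ n = 7 ∨ n = 8) ∧ Nonempty (G ≃g graphE n))

/-- A (simply laced) Dynkin diagram: a finite graph whose connected components are all of
type `A`, `D` or `E`. -/
def IsDynkinDiagram {V : Type*} (G : SimpleGraph V) : Prop :=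
  Finite V ∧ ∀ c : G.ConnectedComponent, c.toSimpleGraph.IsADE

end SimpleGraph

/-! Finiteness for orientations uses only that a Dynkin diagram is a finite forest: every nonempty
set of vertices has a member `v` with at most one neighbour in it. With `a` the generator at `v` and
`T` the submonoid of the others, the orientation of the one possible edge gives `a t a = a t` for
all `t ∈ T`, or `a t a = t a` for all `t ∈ T`. A second `a` can thus be deleted from any word, so
adjoining `a` to `T` gives only `T ∪ TaT` (`finite_closure_insert`).

For the converse, `H_Q` acts on `V → ℤ` by the operators `raise i`; the ends of an arrow act by
commuting idempotents, so only the edges matter. If `H_Q` is finite, the orbit of `0` has an element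
`u ≥ 0` of maximal coordinate sum, which no `raise i` moves: `A u + 1 ≤ 2 u`, with `A` the adjacency
matrix of the edges. Pairing with a weight `δ ≥ 0` such that `2 δ ≤ A δ` forces `δ = 0`
(`isPositive_edges`). The weights of the extended Dynkin diagrams are such `δ`, so none of these
diagrams is a subgraph, and a maximal path argument leaves only types A, D and E
(`IsPositive.isADE`). -/

/-! ### Adjoining an absorbing idempotent to a finite submonoid. -/

namespace Submonoid

/-- Adjoining to a finite submonoid `T` an element `a` such that `a * t * a` is always `a * t`, or
always `t * a`, gives a finite submonoid. -/
theorem finite_closure_insert {M : Type*} [Monoid M] {S : Set M} {a : M}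
    (hS : (closure S : Set M).Finite)
    (h : (∀ t ∈ closure S, a * t * a = a * t) ∨ (∀ t ∈ closure S, a * t * a = t * a)) :
    (closure (insert a S) : Set M).Finite := by
  set T := closure S
  have hTaT : (((fun p : M × M => p.1 * a * p.2) '' ((T : Set M) ×ˢ (T : Set M))) ∪ T).Finite :=
    ((hS.prod hS).image _).union hS
  -- It suffices that `T ∪ TaT` contains `1` and is stable under left multiplication by `S` and by
  -- `a`; in `a * (p * a * q)` the absorption law deletes one `a`.
  refine hTaT.subset fun z hz => ?_
  induction hz using closure_induction_left with
  | one => exact Or.inr T.one_mem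
  | mul_left x hx y _ ih =>
    rcases hx with rfl | hx
    · rcases ih with ⟨⟨p, q⟩, ⟨hp, hq⟩, rfl⟩ | hy
      · rcases h with h | h
        · exact Or.inl ⟨(1, p * q), ⟨T.one_mem, T.mul_mem hp hq⟩, by
            simp only [one_mul]
            rw [← mul_assoc, ← h p hp, ← mul_assoc, ← mul_assoc]⟩
        · exact Or.inl ⟨(p, q), ⟨hp, hq⟩, by
            simp only
            rw [← mul_assoc, ← mul_assoc, h p hp]⟩
      · exact Or.inl ⟨(1, y), ⟨T.one_mem, hy⟩, by simp⟩
    · have hxT : x ∈ T := subset_closure hx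
      rcases ih with ⟨⟨p, q⟩, ⟨hp, hq⟩, rfl⟩ | hy
      · exact Or.inl ⟨(x * p, q), ⟨T.mul_mem hxT hp, hq⟩, by simp [mul_assoc]⟩
      · exact Or.inr (T.mul_mem hxT hy)

/-- For a product, insert an `a` between the factors and absorb from the right: `axya = axaya = axay
= axy`. -/
theorem mul_mul_eq_left_of_mem_closure {M : Type*} [Monoid M] {S : Set M} {a : M}
    (ha : a * a = a) (h : ∀ t ∈ S, a * t * a = a * t) : ∀ t ∈ closure S, a * t * a = a * t := by
  intro t ht
  induction ht using closure_induction with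
  | mem x hx => exact h x hx
  | one => simpa using ha
  | mul x y _ _ hx hy =>
    rw [← mul_assoc, ← hx, mul_assoc (a * x) a y, mul_assoc (a * x), hy]

theorem mul_mul_eq_right_of_mem_closure {M : Type*} [Monoid M] {S : Set M} {a : M}
    (ha : a * a = a) (h : ∀ t ∈ S, a * t * a = t * a) : ∀ t ∈ closure S, a * t * a = t * a := by
  intro t ht
  induction ht using closure_induction with
  | mem x hx => exact h x hx
  | one => simpa using ha
  | mul x y _ _ hx hy =>
    calc a * (x * y) * a = a * x * (y * a) := by simp only [mul_assoc]
      _ = a * x * a * (y * a) := by nth_rw 1 [← hy]; simp only [mul_assoc]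
      _ = x * (a * y * a) := by rw [hx]; simp only [mul_assoc]
      _ = x * y * a := by rw [hy, mul_assoc]

end Submonoid

/-! ### Dynkin diagrams are forests. -/

namespace SimpleGraph

/-- Every nonempty finite set of vertices has a member with at most one neighbour in the set. -/
def IsOneDegenerate {V : Type*} (G : SimpleGraph V) : Prop :=
  ∀ S : Finset V, S.Nonempty → ∃ v ∈ S, ∀ i ∈ S, ∀ j ∈ S, G.Adj v i → G.Adj v j → i = j

/-- In any `S`, the vertex of largest rank has only neighbours of smaller rank. The numbering of the
vertices of `pathGraph` and `branchedPath` is such a rank. -/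
theorem isOneDegenerate_of_rank {V : Type*} {G : SimpleGraph V} (r : V → ℕ)
    (hr : Function.Injective r)
    (h : ∀ v i j, r i < r v → r j < r v → G.Adj v i → G.Adj v j → i = j) :
    G.IsOneDegenerate := by
  intro S hS
  obtain ⟨v, hv, hmax⟩ := S.exists_max_image r hS
  refine ⟨v, hv, fun i hi j hj hvi hvj => h v i j ?_ ?_ hvi hvj⟩
  · exact lt_of_le_of_ne (hmax i hi) fun e => hvi.ne (hr e).symm
  · exact lt_of_le_of_ne (hmax j hj) fun e => hvj.ne (hr e).symm

theorem isOneDegenerate_pathGraph (n : ℕ) : (pathGraph n).IsOneDegenerate :=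
  isOneDegenerate_of_rank Fin.val Fin.val_injective fun v i j hi hj hvi hvj => by
    rw [pathGraph_adj] at hvi hvj
    ext; omega

theorem isOneDegenerate_branchedPath (n k : ℕ) : (branchedPath n k).IsOneDegenerate :=
  isOneDegenerate_of_rank Fin.val Fin.val_injective fun v i j hi hj hvi hvj => by
    simp only [branchedPath, fromRel_adj] at hvi hvj
    ext; omega

theorem IsOneDegenerate.of_iso {V W : Type*} {G : SimpleGraph V} {H : SimpleGraph W}
    (hH : H.IsOneDegenerate) (e : G ≃g H) : G.IsOneDegenerate := by
  intro S hS
  obtain ⟨w, hw, h⟩ := hH (S.map e.toEquiv.toEmbedding) (by simpa using hS)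
  obtain ⟨v, hv, rfl⟩ := Finset.mem_map.1 hw
  refine ⟨v, hv, fun i hi j hj hvi hvj => e.injective (h _ ?_ _ ?_ ?_ ?_)⟩
  · exact Finset.mem_map_of_mem _ hi
  · exact Finset.mem_map_of_mem _ hj
  · exact e.map_rel_iff.2 hvi
  · exact e.map_rel_iff.2 hvj

theorem IsADE.isOneDegenerate {V : Type*} {G : SimpleGraph V} (hG : G.IsADE) :
    G.IsOneDegenerate := by
  rcases hG with ⟨n, -, ⟨e⟩⟩ | ⟨n, -, ⟨e⟩⟩ | ⟨n, -, ⟨e⟩⟩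
  · exact (isOneDegenerate_pathGraph n).of_iso e
  · exact (isOneDegenerate_branchedPath n _).of_iso e
  · exact (isOneDegenerate_branchedPath n _).of_iso e

theorem IsDynkinDiagram.isOneDegenerate {V : Type*} {G : SimpleGraph V} (hG : G.IsDynkinDiagram) :
    G.IsOneDegenerate := by
  classical
  rintro S ⟨s, hs⟩
  set c := G.connectedComponentMk s
  obtain ⟨⟨v, hvc⟩, hv, h⟩ := (hG.2 c).isOneDegenerate (S.subtype (· ∈ c.supp))
    ⟨⟨s, rfl⟩, by simpa using hs⟩
  rw [Finset.mem_subtype] at hv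
  have key : ∀ i, G.Adj v i → i ∈ c.supp := fun i hi =>
    (c.mem_supp_congr_adj hi).1 hvc
  refine ⟨v, hv, fun i hi j hj hvi hvj => ?_⟩
  have := h ⟨i, key i hvi⟩ (by simpa using hi) ⟨j, key j hvj⟩ (by simpa using hj) hvi hvj
  exact congrArg Subtype.val this

end SimpleGraph

/-! ### Finiteness of `H_Q` for orientations of Dynkin diagrams. -/

namespace MixedGraph

variable {V : Type*} (Q : MixedGraph V)

/-- The generator of the Hecke–Kiselman monoid at a vertex. -/
def gen (i : V) : Q.HeckeKiselman := PresentedMonoid.of Q.Rel i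

variable {Q}

theorem gen_mul_self (i : V) : Q.gen i * Q.gen i = Q.gen i :=
  PresentedMonoid.mk_eq_mk_of_rel (Rel.idem i)

theorem gen_comm {i j : V} (h : ¬ Q.Connects i j) : Q.gen i * Q.gen j = Q.gen j * Q.gen i :=
  PresentedMonoid.mk_eq_mk_of_rel (Rel.comm i j h)

theorem gen_mul_gen_mul_gen {i j : V} (h : Q.arrow i j) :
    Q.gen i * Q.gen j * Q.gen i = Q.gen i * Q.gen j :=
  (PresentedMonoid.mk_eq_mk_of_rel (Rel.arrow_left i j h)).symm

theorem gen_mul_gen_mul_gen' {i j : V} (h : Q.arrow i j) :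
    Q.gen j * Q.gen i * Q.gen j = Q.gen i * Q.gen j :=
  (PresentedMonoid.mk_eq_mk_of_rel (Rel.arrow_right i j h)).symm

theorem gen_absorb_of_not_connects {i j : V} (h : ¬ Q.Connects i j) :
    Q.gen i * Q.gen j * Q.gen i = Q.gen i * Q.gen j ∧
      Q.gen i * Q.gen j * Q.gen i = Q.gen j * Q.gen i := by
  constructor
  · rw [mul_assoc, ← gen_comm h, ← mul_assoc, gen_mul_self]
  · rw [gen_comm h, mul_assoc, gen_mul_self]

theorem finite_closure_gen {C : SimpleGraph V} (hC : C.IsOneDegenerate)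
    (hQ : Q.IsOrientationOf C) (S : Finset V) :
    (Submonoid.closure (Q.gen '' S) : Set Q.HeckeKiselman).Finite := by
  classical
  induction S using Finset.strongInduction with
  | H S ih =>
    rcases S.eq_empty_or_nonempty with rfl | hS
    · simp
    obtain ⟨v, hv, huniq⟩ := hC S hS
    have hconn : ∀ i, Q.Connects v i ↔ C.Adj v i := fun i => by simp [Connects, hQ.1, hQ.2]
    rw [← Finset.insert_erase hv, Finset.coe_insert, Set.image_insert_eq]
    refine Submonoid.finite_closure_insert (ih _ (Finset.erase_ssubset hv)) ?_
    -- Generators commuting with `gen v` obey both absorption laws, so the direction of the one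
    -- possible arrow between `v` and `S` decides which law holds throughout.
    by_cases hout : ∃ i ∈ S, Q.arrow i v
    · obtain ⟨i, hi, hiv⟩ := hout
      right
      refine Submonoid.mul_mul_eq_right_of_mem_closure (gen_mul_self v) ?_
      rintro _ ⟨j, hj, rfl⟩
      have hjS := Finset.mem_of_mem_erase hj
      by_cases hvj : Q.Connects v j
      · obtain rfl := huniq i hi j hjS ((hQ.2 _ _).2 (Or.inr hiv)) ((hconn j).1 hvj)
        exact gen_mul_gen_mul_gen' hiv
      · exact (gen_absorb_of_not_connects hvj).2
    · left
      refine Submonoid.mul_mul_eq_left_of_mem_closure (gen_mul_self v) ?_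
      rintro _ ⟨j, hj, rfl⟩
      have hjS := Finset.mem_of_mem_erase hj
      by_cases hvj : Q.Connects v j
      · rcases hvj with h | h | h
        · simp [hQ.1] at h
        · exact gen_mul_gen_mul_gen h
        · exact absurd ⟨j, hjS, h⟩ hout
      · exact (gen_absorb_of_not_connects hvj).1

theorem finite_of_isOrientationOf {C : SimpleGraph V} (hC : C.IsDynkinDiagram)
    (hQ : Q.IsOrientationOf C) : Finite Q.HeckeKiselman := by
  have := hC.1
  cases nonempty_fintype V
  have h := finite_closure_gen hC.isOneDegenerate hQ Finset.univ
  rw [Finset.coe_univ, Set.image_univ] at h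
  have htop : Submonoid.closure (Set.range Q.gen) = ⊤ := PresentedMonoid.closure_range_of Q.Rel
  rw [htop] at h
  exact Set.finite_univ_iff.1 h

end MixedGraph

/-! ### Positivity and the raising operators. -/

namespace SimpleGraph

/-- No nonzero `δ : V → ℕ` satisfies `2 δ ≤ A δ`, with `A` the adjacency matrix. -/
def IsPositive {V : Type*} [Fintype V] (G : SimpleGraph V) : Prop :=
  open Classical in
  ∀ δ : V → ℕ, (∀ i, 2 * δ i ≤ ∑ j with G.Adj i j, δ j) → δ = 0

section
open Classical

variable {V : Type*} [Fintype V] (G : SimpleGraph V)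

/-- The sum of `u` over the neighbours of `i`. -/
noncomputable def nbrSum (u : V → ℤ) (i : V) : ℤ := ∑ j with G.Adj i j, u j

/-- The piecewise linear operator at the vertex `i`, replacing the value `u i` by its reflection
whenever this is larger. -/
noncomputable def raise (i : V) : Function.End (V → ℤ) := fun u =>
  -- The summand `1` makes the reflection affine; without it the zero vector would be fixed.
  Function.update u i (max (u i) (G.nbrSum u i - u i + 1))

variable {G}

theorem nbrSum_update_of_adj {i j : V} (h : G.Adj i j) (u : V → ℤ) (t : ℤ) :
    G.nbrSum (Function.update u j t) i = G.nbrSum u i - u j + t := by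
  have hj : j ∈ Finset.univ.filter (G.Adj i) := by simpa using h
  simp only [nbrSum]
  rw [Finset.sum_update_of_mem hj, ← Finset.sum_sdiff (Finset.singleton_subset_iff.2 hj)]
  simp; ring

theorem nbrSum_update_of_not_adj {i j : V} (h : ¬ G.Adj i j) (u : V → ℤ) (t : ℤ) :
    G.nbrSum (Function.update u j t) i = G.nbrSum u i := by
  simp only [nbrSum]
  rw [Finset.sum_update_of_notMem]
  simpa using h

theorem raise_mul_self (i : V) : G.raise i * G.raise i = G.raise i := by
  funext u
  simp only [Function.End.mul_def, Function.comp, raise,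
    nbrSum_update_of_not_adj (G.loopless.irrefl i), Function.update_idem, Function.update_self]
  congr 1
  omega

theorem raise_comm {i j : V} (h : ¬ G.Adj i j) :
    G.raise i * G.raise j = G.raise j * G.raise i := by
  obtain rfl | hij := eq_or_ne i j
  · rfl
  have h' : ¬ G.Adj j i := fun e => h e.symm
  funext u
  simp only [Function.End.mul_def, Function.comp, raise, nbrSum_update_of_not_adj h,
    nbrSum_update_of_not_adj h', Function.update_of_ne hij, Function.update_of_ne hij.symm]
  rw [Function.update_comm hij]

theorem raise_braid {i j : V} (h : G.Adj i j) :
    G.raise i * G.raise j * G.raise i = G.raise j * G.raise i * G.raise j := by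
  have hij := h.ne
  funext u k
  change G.raise i (G.raise j (G.raise i u)) k = G.raise j (G.raise i (G.raise j u)) k
  -- Only the coordinates `i` and `j` move; there both sides are max-plus expressions in `u i`, `u
  -- j` and the two neighbour sums.
  by_cases hki : k = i
  · subst hki
    simp only [raise, nbrSum_update_of_adj h,
      nbrSum_update_of_adj h.symm, Function.update_of_ne hij, Function.update_of_ne hij.symm,
      nbrSum_update_of_not_adj (G.loopless.irrefl _), Function.update_self]
    omega
  by_cases hkj : k = j
  · subst hkj
    simp only [raise, nbrSum_update_of_adj h,
      nbrSum_update_of_adj h.symm, Function.update_of_ne hij, Function.update_of_ne hij.symm,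
      nbrSum_update_of_not_adj (G.loopless.irrefl _), Function.update_self]
    omega
  · simp only [raise, Function.update_of_ne hki,
      Function.update_of_ne hkj]

end

end SimpleGraph

/-! ### Consequences of the finiteness of `H_Q`. -/

namespace MixedGraph

variable {V : Type*} (Q : MixedGraph V)

/-- Idempotents satisfying the braid relations of the edges and commuting otherwise define a
homomorphism from the Hecke–Kiselman monoid. -/
def liftOfBraid {M : Type*} [Monoid M] (f : V → M) (idem : ∀ i, f i * f i = f i)
    (comm : ∀ i j, ¬ Q.edges.Adj i j → f i * f j = f j * f i)
    (braid : ∀ i j, Q.edges.Adj i j → f i * f j * f i = f j * f i * f j) :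
    Q.HeckeKiselman →* M :=
  PresentedMonoid.lift f <| by
    intro a b h
    cases h with
    | idem i => simpa using idem i
    | comm i j h => simpa using comm i j fun e => h (Or.inl e)
    | braid i j h => simpa using braid i j h
    -- The ends of an arrow are not joined by an edge, so their images commute; for commuting
    -- idempotents `ij = iji = jij`.
    | arrow_left i j h =>
      have := comm i j (Q.arrow_not_edge i j h)
      simp only [map_mul, FreeMonoid.lift_eval_of]
      rw [mul_assoc, ← this, ← mul_assoc, idem]
    | arrow_right i j h =>
      have := comm i j (Q.arrow_not_edge i j h)
      simp only [map_mul, FreeMonoid.lift_eval_of]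
      rw [← this, mul_assoc, idem]

@[simp]
theorem liftOfBraid_of {M : Type*} [Monoid M] (f : V → M) (idem : ∀ i, f i * f i = f i)
    (comm : ∀ i j, ¬ Q.edges.Adj i j → f i * f j = f j * f i)
    (braid : ∀ i j, Q.edges.Adj i j → f i * f j * f i = f j * f i * f j) (i : V) :
    Q.liftOfBraid f idem comm braid (PresentedMonoid.of Q.Rel i) = f i :=
  PresentedMonoid.lift_of _ _

/-- The operators inserting `i` into a set are commuting idempotents, and their values at `∅` show
that the generators are distinct. -/
theorem finite_vertices [Finite Q.HeckeKiselman] : Finite V := by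
  let f : V → Function.End (Set V) := fun i S => insert i S
  have hcomm : ∀ i j, f i * f j = f j * f i := fun i j => by
    funext S; exact Set.insert_comm i j S
  have hidem : ∀ i, f i * f i = f i := fun i => by
    funext S; exact Set.insert_idem i S
  have hbraid : ∀ i j, f i * f j * f i = f j * f i * f j := fun i j => by
    rw [mul_assoc, hcomm j i, ← mul_assoc, hidem, mul_assoc, hidem]
  refine Finite.of_injective (fun i => PresentedMonoid.of Q.Rel i) fun i j hij => ?_
  have h : f i ∅ = f j ∅ := by
    rw [← Q.liftOfBraid_of f hidem (fun i j _ => hcomm i j) (fun i j _ => hbraid i j) i]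
    simp only at hij
    rw [hij, liftOfBraid_of]
  simpa [f] using h

theorem isPositive_edges [Fintype V] [Finite Q.HeckeKiselman] : Q.edges.IsPositive := by
  classical
  intro δ hδ
  by_contra hne
  let φ := Q.liftOfBraid Q.edges.raise (fun i => SimpleGraph.raise_mul_self i)
    (fun i j h => SimpleGraph.raise_comm h) (fun i j h => SimpleGraph.raise_braid h)
  have hof : ∀ i, φ (PresentedMonoid.of Q.Rel i) = Q.edges.raise i := fun i =>
    Q.liftOfBraid_of _ _ _ _ i
  have hmul : ∀ i h, φ (PresentedMonoid.of Q.Rel i * h) 0 = Q.edges.raise i (φ h 0) :=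
    fun i h => by rw [map_mul, hof]; rfl
  have hnonneg : ∀ h : Q.HeckeKiselman, 0 ≤ φ h 0 := by
    intro h
    induction h using Submonoid.induction_of_closure_eq_top_left
      (PresentedMonoid.closure_range_of Q.Rel) with
    | one => rw [map_one]; exact le_refl _
    | mul_left x hx y ih =>
      obtain ⟨i, rfl⟩ := hx
      rw [hmul]
      intro k
      by_cases hk : k = i
      · subst hk
        simp only [SimpleGraph.raise, Function.update_self]
        exact le_max_of_le_left (ih k)
      · simp only [SimpleGraph.raise, Function.update_of_ne hk]
        exact ih k
  obtain ⟨h, hmax⟩ := Finite.exists_max fun h : Q.HeckeKiselman => ∑ i, φ h 0 i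
  set u := φ h 0
  have hu : ∀ i, 0 ≤ u i := hnonneg h
  -- Otherwise `raise i` would strictly increase the coordinate sum of `u`, which is maximal.
  have hstuck : ∀ i, Q.edges.nbrSum u i + 1 ≤ 2 * u i := by
    intro i
    by_contra hlt
    have := hmax (PresentedMonoid.of Q.Rel i * h)
    rw [hmul] at this
    change ∑ k, Q.edges.raise i u k ≤ ∑ k, u k at this
    simp only [SimpleGraph.raise] at this
    rw [Finset.sum_update_of_mem (Finset.mem_univ i),
      ← Finset.sum_sdiff (Finset.subset_univ {i}), Finset.sum_singleton] at this
    omega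
  have hpos : 0 < ∑ i, (δ i : ℤ) := by
    refine Finset.sum_pos' (fun i _ => by positivity) ?_
    obtain ⟨i, hi⟩ := Function.ne_iff.1 hne
    exact ⟨i, Finset.mem_univ i, by exact_mod_cast Nat.pos_of_ne_zero hi⟩
  have h1 : ∑ i, (δ i : ℤ) * Q.edges.nbrSum u i + ∑ i, (δ i : ℤ) ≤ ∑ i, (δ i : ℤ) * (2 * u i) := by
    rw [← Finset.sum_add_distrib]
    refine Finset.sum_le_sum fun i _ => ?_
    nlinarith [hstuck i, (Int.natCast_nonneg (δ i))]
  -- Symmetry of the adjacency matrix moves it from `u` to `δ`.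
  have h2 : ∑ i, (δ i : ℤ) * Q.edges.nbrSum u i =
      ∑ j, u j * ∑ i with Q.edges.Adj j i, (δ i : ℤ) := by
    simp only [SimpleGraph.nbrSum, Finset.mul_sum, Finset.sum_filter]
    rw [Finset.sum_comm]
    refine Finset.sum_congr rfl fun j _ => Finset.sum_congr rfl fun i _ => ?_
    simp only [Q.edges.adj_comm i j]
    split_ifs <;> ring
  have h3 : ∑ i, (δ i : ℤ) * (2 * u i) ≤ ∑ j, u j * ∑ i with Q.edges.Adj j i, (δ i : ℤ) := by
    refine Finset.sum_le_sum fun j _ => ?_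
    have : (2 : ℤ) * δ j ≤ ∑ i with Q.edges.Adj j i, (δ i : ℤ) := by exact_mod_cast hδ j
    nlinarith [hu j]
  linarith

end MixedGraph

/-! ### Subgraphs of positive graphs, and path sequences. -/

namespace SimpleGraph

variable {V : Type*} {G : SimpleGraph V}

/-- A positive graph contains no weighted subgraph in which twice each weight is at most the sum
of the neighbouring weights. -/
theorem IsPositive.weight_eq_zero [Fintype V] (hG : G.IsPositive) {ι : Type*} (S : Finset ι)
    {f : ι → V} (hf : Set.InjOn f S) (w : ι → ℕ)
    (h : ∀ i ∈ S, ∃ l : List ι, l.Nodup ∧ (∀ j ∈ l, j ∈ S ∧ G.Adj (f i) (f j)) ∧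
      2 * w i ≤ (l.map w).sum) : ∀ i ∈ S, w i = 0 := by
  classical
  let δ : V → ℕ := fun v => ∑ i ∈ S with f i = v, w i
  have hδf : ∀ i ∈ S, δ (f i) = w i := fun i hi => by
    have : S.filter (fun j => f j = f i) = {i} := by
      ext j
      simp only [Finset.mem_filter, Finset.mem_singleton]
      exact ⟨fun hj => hf hj.1 hi hj.2, by rintro rfl; exact ⟨hi, rfl⟩⟩
    simp only [δ, this, Finset.sum_singleton]
  have hδ : δ = 0 := by
    refine hG δ fun v => ?_
    by_cases hv : ∃ i ∈ S, f i = v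
    · obtain ⟨i, hi, rfl⟩ := hv
      obtain ⟨l, hl, hadj, hw⟩ := h i hi
      rw [hδf i hi]
      refine hw.trans ?_
      rw [← List.sum_toFinset w hl]
      have hsub : ∀ j ∈ l.toFinset, j ∈ S := fun j hj => (hadj j (List.mem_toFinset.1 hj)).1
      rw [← Finset.sum_congr rfl fun j hj => hδf j (hsub j hj),
        ← Finset.sum_image (f := δ) (g := f) fun a ha b hb e => hf (hsub a ha) (hsub b hb) e]
      -- Neighbours missing from `l` only enlarge the sum, so the weighted subgraph need not be
      -- induced.
      refine Finset.sum_le_sum_of_subset fun u hu => ?_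
      obtain ⟨j, hj, rfl⟩ := Finset.mem_image.1 hu
      simpa using (hadj j (List.mem_toFinset.1 hj)).2
    · have : δ v = 0 := Finset.sum_eq_zero fun i hi =>
        absurd ⟨i, (Finset.mem_filter.1 hi).1, (Finset.mem_filter.1 hi).2⟩ hv
      simp [this]
  intro i hi
  rw [← hδf i hi, hδ]; rfl

theorem IsPositive.of_hom [Fintype V] (hG : G.IsPositive) {W : Type*} [Fintype W]
    {H : SimpleGraph W} (f : H →g G) (hf : Function.Injective f) : H.IsPositive := by
  classical
  intro δ hδ
  funext i
  refine hG.weight_eq_zero Finset.univ (f := f) hf.injOn δ (fun i _ => ?_) i (Finset.mem_univ i)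
  refine ⟨(Finset.univ.filter fun j => H.Adj i j).toList, Finset.nodup_toList _,
    fun j hj => ⟨Finset.mem_univ j, f.map_adj (by simpa using hj)⟩, ?_⟩
  rw [Finset.sum_map_toList]
  convert hδ i

theorem IsPositive.isAcyclic [Fintype V] (hG : G.IsPositive) : G.IsAcyclic := by
  classical
  intro v p hp
  -- A cycle with all weights `1` is an extended diagram of type `A`.
  have := hG.weight_eq_zero p.support.toFinset (f := id) (Set.injOn_id _) (fun _ => 1)
    (fun i hi => ?_) v (by simp)
  · exact one_ne_zero this
  · rw [List.mem_toFinset] at hi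
    obtain ⟨a, b, hab, he⟩ := Set.ncard_eq_two.1 (hp.ncard_neighborSet_toSubgraph_eq_two hi)
    refine ⟨[a, b], by simpa using hab, fun j hj => ?_, by simp⟩
    have hj' : j ∈ p.toSubgraph.neighborSet i := by rw [he]; simpa using hj
    rw [Subgraph.mem_neighborSet] at hj'
    exact ⟨List.mem_toFinset.2 ((p.mem_verts_toSubgraph).1 (p.toSubgraph.edge_vert hj'.symm)),
      p.toSubgraph.adj_sub hj'⟩

/-- A bijective homomorphism from a connected graph to an acyclic one is an isomorphism. -/
theorem IsAcyclic.nonempty_iso_of_bijective (hG : G.IsAcyclic) {W : Type*} {H : SimpleGraph W}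
    (hH : H.Preconnected) (f : H →g G) (hf : Function.Bijective f) : Nonempty (G ≃g H) := by
  suffices h : ∀ a b, G.Adj (f a) (f b) → H.Adj a b from
    ⟨(⟨Equiv.ofBijective f hf, fun {a b} => ⟨h a b, f.map_adj⟩⟩ : H ≃g G).symm⟩
  intro a b hab
  by_contra hnot
  -- An edge of `G` not coming from `H` would be a bridge, yet the connected image of `H` avoids it
  -- and joins its ends.
  have hbr := isAcyclic_iff_forall_adj_isBridge.1 hG hab
  rw [isBridge_iff] at hbr
  let f' : H →g G.deleteEdges {s(f a, f b)} :=
    ⟨f, fun {c d} hcd => by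
      rw [deleteEdges_adj]
      refine ⟨f.map_adj hcd, fun he => hnot ?_⟩
      rw [Set.mem_singleton_iff, Sym2.eq_iff] at he
      rcases he with ⟨h1, h2⟩ | ⟨h1, h2⟩
      · rwa [← hf.1 h1, ← hf.1 h2]
      · rw [← hf.1 h1, ← hf.1 h2]; exact hcd.symm⟩
  exact hbr ((hH a b).map f')

theorem branchedPath_preconnected {n k : ℕ} (hk : k + 1 < n) : (branchedPath n k).Preconnected := by
  have h0 : ∀ i (hi : i + 1 < n),
      (branchedPath n k).Reachable ⟨0, by omega⟩ ⟨i, by omega⟩ := by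
    intro i hi
    induction i with
    | zero => exact Reachable.refl _
    | succ i ih =>
      refine (ih (by omega)).trans (Adj.reachable ?_)
      rw [branchedPath, fromRel_adj]
      exact ⟨by simp, Or.inl (Or.inl ⟨rfl, hi⟩)⟩
  have h1 : ∀ i, (branchedPath n k).Reachable ⟨0, by omega⟩ i := by
    intro i
    by_cases hi : (i : ℕ) + 1 < n
    · exact h0 i hi
    · refine (h0 k hk).trans (Adj.reachable ?_)
      rw [branchedPath, fromRel_adj]
      refine ⟨fun e => ?_, Or.inl (Or.inr ⟨rfl, by omega⟩)⟩
      rw [← e] at hi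
      exact hi hk
  exact fun a b => (h1 a).symm.trans (h1 b)

/-- The sequence `x` of length `m`, followed by `l`. -/
def attach (x : ℕ → V) (m : ℕ) (l : V) : ℕ → V := fun n => if n < m then x n else l

theorem attach_of_lt {x : ℕ → V} {m n : ℕ} {l : V} (h : n < m) : attach x m l n = x n := if_pos h

theorem attach_self {x : ℕ → V} {m : ℕ} {l : V} : attach x m l m = l := if_neg (lt_irrefl m)

theorem injOn_attach {x : ℕ → V} {m : ℕ} {l : V} (hx : Set.InjOn x (Set.Iio m))
    (hl : ∀ i < m, x i ≠ l) : Set.InjOn (attach x m l) (Set.Iio (m + 1)) := by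
  intro a ha b hb hab
  simp only [Set.mem_Iio] at ha hb
  simp only [attach] at hab
  split_ifs at hab with h1 h2 h2
  · exact hx h1 h2 hab
  · exact absurd hab (hl a h1)
  · exact absurd hab.symm (hl b h2)
  · omega

/-- `x 0, …, x (m - 1)` are the successive vertices of a path in `G`. -/
structure IsPathSeq (G : SimpleGraph V) (x : ℕ → V) (m : ℕ) : Prop where
  injOn : Set.InjOn x (Set.Iio m)
  adj : ∀ i, i + 1 < m → G.Adj (x i) (x (i + 1))

/-- `x 0, …, x (m - 1)` is a path in `G` and `l` is another vertex, adjacent to the interior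
vertex `x k`. -/
structure IsBranchedSeq (G : SimpleGraph V) (x : ℕ → V) (l : V) (m k : ℕ) : Prop
    extends IsPathSeq G x m where
  ne : ∀ i < m, x i ≠ l
  adj_leaf : G.Adj (x k) l
  one_le : 1 ≤ k
  lt : k + 1 < m

theorem IsPathSeq.le_card [Fintype V] {x : ℕ → V} {m : ℕ} (h : G.IsPathSeq x m) :
    m ≤ Fintype.card V := by
  simpa using Finset.card_le_card_of_injOn (s := Finset.range m) (t := Finset.univ) x (by simp)
    (by simpa using h.injOn)

theorem IsPathSeq.adj_pred {x : ℕ → V} {m : ℕ} (h : G.IsPathSeq x m) {i : ℕ} (h1 : 1 ≤ i)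
    (hi : i < m) : G.Adj (x i) (x (i - 1)) := by
  obtain ⟨i, rfl⟩ := Nat.exists_eq_add_of_le' h1
  exact (h.adj i hi).symm

theorem IsPathSeq.reverse {x : ℕ → V} {m : ℕ} (h : G.IsPathSeq x m) :
    G.IsPathSeq (fun n => x (m - 1 - n)) m where
  injOn a ha b hb hab := by
    simp only [Set.mem_Iio] at ha hb
    have := h.injOn (Set.mem_Iio.2 (by omega)) (Set.mem_Iio.2 (by omega)) hab
    omega
  adj i hi := by
    have := h.adj_pred (i := m - 1 - i) (by omega) (by omega)
    rwa [Nat.sub_sub _ i 1] at this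

theorem IsPathSeq.cons {x : ℕ → V} {m : ℕ} (h : G.IsPathSeq x m) {v : V}
    (hv : ∀ i < m, x i ≠ v) (hadj : G.Adj v (x 0)) :
    G.IsPathSeq (fun n => if n = 0 then v else x (n - 1)) (m + 1) where
  injOn a ha b hb hab := by
    simp only [Set.mem_Iio] at ha hb
    simp only at hab
    split_ifs at hab with h1 h2 h2
    · omega
    · exact absurd hab.symm (hv _ (by omega))
    · exact absurd hab (hv _ (by omega))
    · have := h.injOn (Set.mem_Iio.2 (by omega)) (Set.mem_Iio.2 (by omega)) hab
      omega
  adj i hi := by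
    rcases i with _ | i
    · simpa using hadj
    · simpa using h.adj i (by omega)

theorem IsPathSeq.drop {x : ℕ → V} {m : ℕ} (h : G.IsPathSeq x (m + 1)) :
    G.IsPathSeq (fun n => x (n + 1)) m where
  injOn a ha b hb hab := by
    simp only [Set.mem_Iio] at ha hb
    have := h.injOn (Set.mem_Iio.2 (by omega)) (Set.mem_Iio.2 (by omega)) hab
    omega
  adj i hi := h.adj (i + 1) (by omega)

theorem IsBranchedSeq.reverse {x : ℕ → V} {l : V} {m k : ℕ} (h : G.IsBranchedSeq x l m k) :
    G.IsBranchedSeq (fun n => x (m - 1 - n)) l m (m - 1 - k) where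
  toIsPathSeq := h.toIsPathSeq.reverse
  ne i hi := h.ne _ (by omega)
  adj_leaf := by
    have := h.lt
    rw [show m - 1 - (m - 1 - k) = k by omega]
    exact h.adj_leaf
  one_le := by have := h.lt; omega
  lt := by have := h.lt; have := h.one_le; omega

theorem IsBranchedSeq.cons {x : ℕ → V} {l : V} {m k : ℕ} (h : G.IsBranchedSeq x l m k) {v : V}
    (hv : ∀ i < m, x i ≠ v) (hvl : v ≠ l) (hadj : G.Adj v (x 0)) :
    G.IsBranchedSeq (fun n => if n = 0 then v else x (n - 1)) l (m + 1) (k + 1) where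
  toIsPathSeq := h.toIsPathSeq.cons hv hadj
  ne i hi := by
    split_ifs
    · exact hvl
    · exact h.ne _ (by omega)
  adj_leaf := by simpa using h.adj_leaf
  one_le := by omega
  lt := by have := h.lt; omega

/-- When the branch vertex is next to the start of the path, a neighbour of the leaf makes the
path longer, the former start becoming the leaf. -/
theorem IsBranchedSeq.exchange {x : ℕ → V} {l : V} {m : ℕ} (h : G.IsBranchedSeq x l m 1) {v : V}
    (hv : ∀ i < m, x i ≠ v) (hadj : G.Adj v l) :
    ∃ y, G.IsBranchedSeq y (x 0) (m + 1) 2 := by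
  have hm := h.lt
  obtain ⟨m, rfl⟩ : ∃ m', m = m' + 1 := ⟨m - 1, by omega⟩
  -- The new path is `v, l, x 1, x 2, …`; the vertex `x 0` hangs from `x 1`, now at index `2`.
  have h1 := h.toIsPathSeq.drop.cons (v := l) (fun i hi => h.ne _ (by omega)) h.adj_leaf.symm
  have h2 := h1.cons (v := v) (fun i hi => by
    split_ifs
    · exact hadj.ne'
    · exact hv _ (by omega)) (by simpa using hadj)
  refine ⟨_, h2, fun i hi => ?_, ?_, by omega, by omega⟩
  · split_ifs
    · exact (hv 0 (by omega)).symm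
    · exact (h.ne 0 (by omega)).symm
    · intro e
      have := h.injOn (Set.mem_Iio.2 (by omega)) (Set.mem_Iio.2 (by omega)) e
      omega
  · simpa using (h.adj 0 (by omega)).symm

end SimpleGraph

/-! ### Excluding the extended Dynkin diagrams. -/

namespace SimpleGraph

variable {V : Type*} {G : SimpleGraph V}

/-- No extended Dynkin diagram of type `D` in a positive graph. -/
theorem IsPositive.not_two_branches [Fintype V] (hG : G.IsPositive) {x : ℕ → V} {l v : V}
    {m k j : ℕ} (h : G.IsBranchedSeq x l m k) (h' : G.IsBranchedSeq x v m j) (hvl : v ≠ l)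
    (hkj : k ≤ j) : False := by
  have hk := h.one_le
  have hj := h'.lt
  -- A single sequence lists the whole diagram, with `l` at index `m` and `v` at `m + 1`, so that
  -- weights are functions of the index.
  have hx : ∀ n < m, attach (attach x m l) (m + 1) v n = x n := fun n hn => by
    rw [attach_of_lt (by omega), attach_of_lt hn]
  have hl : attach (attach x m l) (m + 1) v m = l := by
    rw [attach_of_lt (by omega), attach_self]
  have hv : attach (attach x m l) (m + 1) v (m + 1) = v := attach_self
  have hinj : Set.InjOn (attach (attach x m l) (m + 1) v) (Set.Iio (m + 1 + 1)) :=
    injOn_attach (injOn_attach h.injOn h.ne) fun i hi => by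
      rcases Nat.lt_succ_iff_lt_or_eq.1 hi with hi | rfl
      · rw [attach_of_lt hi]; exact h'.ne i hi
      · rw [attach_self]; exact hvl.symm
  generalize attach (attach x m l) (m + 1) v = f at hx hl hv hinj
  have hs : ∀ n, n + 1 < m → G.Adj (f n) (f (n + 1)) := fun n hn => by
    rw [hx n (by omega), hx _ hn]; exact h.adj n hn
  have hp : ∀ n, 1 ≤ n → n < m → G.Adj (f n) (f (n - 1)) := fun n h1 hn => by
    rw [hx n hn, hx _ (by omega)]; exact h.adj_pred h1 hn
  have hkl : G.Adj (f k) (f m) := by rw [hx k (by omega), hl]; exact h.adj_leaf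
  have hjv : G.Adj (f j) (f (m + 1)) := by rw [hx j (by omega), hv]; exact h'.adj_leaf
  -- Weight `2` from one branch vertex to the other, and `1` at the four ends; for `k = j` this is a
  -- star with four leaves.
  let w : ℕ → ℕ := fun n => if k ≤ n ∧ n ≤ j then 2 else 1
  have hw2 : ∀ n, k ≤ n → n ≤ j → w n = 2 := fun n h1 h2 => if_pos ⟨h1, h2⟩
  have hw1 : ∀ n, 1 ≤ w n := fun n => by simp only [w]; split_ifs <;> omega
  have hwlt : ∀ n, n < k → w n = 1 := fun n h1 => if_neg (by omega)
  have hwgt : ∀ n, j < n → w n = 1 := fun n h1 => if_neg (by omega)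
  clear_value w
  have key := hG.weight_eq_zero (Finset.Icc (k - 1) (j + 1) ∪ {m, m + 1})
    (hinj.mono fun n hn => by
      simp only [Finset.coe_union, Finset.coe_Icc, Finset.coe_insert, Finset.coe_singleton,
        Set.mem_union, Set.mem_Icc, Set.mem_insert_iff, Set.mem_singleton_iff] at hn
      simp only [Set.mem_Iio]; omega) w (fun n hn => ?_) m (by simp)
  · have := hw1 m; omega
  simp only [Finset.mem_union, Finset.mem_Icc, Finset.mem_insert, Finset.mem_singleton] at hn ⊢
  have hne : ∀ a b c d : ℕ, a ≠ b → a ≠ c → b ≠ c → a ≠ d → b ≠ d → c ≠ d → [a, b, c, d].Nodup := by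
    intros; simp; omega
  have hne3 : ∀ a b c : ℕ, a ≠ b → a ≠ c → b ≠ c → [a, b, c].Nodup := by intros; simp; omega
  obtain rfl | rfl | hn' : n = m ∨ n = m + 1 ∨ n < m := by omega
  · refine ⟨[k], by simp, by simpa using ⟨by omega, hkl.symm⟩, ?_⟩
    simp [hw2 k le_rfl hkj, hwgt n (by omega)]
  · refine ⟨[j], by simp, by simpa using ⟨by omega, hjv.symm⟩, ?_⟩
    simp [hw2 j hkj le_rfl, hwgt (m + 1) (by omega)]
  have hn1 : n < k ∨ n = k ∧ k = j ∨ n = k ∧ k < j ∨ k < n ∧ n < j ∨ k < j ∧ n = j ∨ j < n := by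
    omega
  rcases hn1 with h1 | ⟨rfl, rfl⟩ | ⟨rfl, h1⟩ | ⟨h1, h2⟩ | ⟨h1, rfl⟩ | h1
  · obtain rfl : n + 1 = k := by omega
    refine ⟨[n + 1], by simp, by simpa using ⟨by omega, hs n (by omega)⟩, ?_⟩
    simp [hwlt n h1, hw2 (n + 1) le_rfl hkj]
  · refine ⟨[n - 1, n + 1, m, m + 1], hne _ _ _ _ (by omega) (by omega) (by omega) (by omega)
      (by omega) (by omega), ?_, ?_⟩
    · simp only [List.forall_mem_cons]
      exact ⟨⟨by omega, hp n hk (by omega)⟩, ⟨by omega, hs n (by omega)⟩, ⟨by simp, hkl⟩,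
        ⟨by simp, hjv⟩, by simp⟩
    · have := hw1 (n - 1); have := hw1 (n + 1); have := hw1 m; have := hw1 (m + 1)
      simp [hw2 n le_rfl le_rfl]; omega
  · refine ⟨[n - 1, n + 1, m], hne3 _ _ _ (by omega) (by omega) (by omega), ?_, ?_⟩
    · simp only [List.forall_mem_cons]
      exact ⟨⟨by omega, hp n hk (by omega)⟩, ⟨by omega, hs n (by omega)⟩, ⟨by simp, hkl⟩, by simp⟩
    · have := hw1 (n - 1); have := hw1 m
      simp [hw2 n le_rfl hkj, hw2 (n + 1) (by omega) (by omega)]; omega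
  · refine ⟨[n - 1, n + 1], by simp, ?_, ?_⟩
    · simp only [List.forall_mem_cons]
      exact ⟨⟨by omega, hp n (by omega) (by omega)⟩, ⟨by omega, hs n (by omega)⟩, by simp⟩
    · simp [hw2 n h1.le h2.le, hw2 (n + 1) (by omega) (by omega),
        hw2 (n - 1) (by omega) (by omega)]
  · refine ⟨[n - 1, n + 1, m + 1],
      hne3 _ _ _ (by omega) (by omega) (by omega), ?_, ?_⟩
    · simp only [List.forall_mem_cons]
      exact ⟨⟨by omega, hp n (by omega) (by omega)⟩, ⟨by omega, hs n (by omega)⟩,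
        ⟨by simp, hjv⟩, by simp⟩
    · have := hw1 (n + 1); have := hw1 (m + 1)
      simp [hw2 n hkj le_rfl, hw2 (n - 1) (by omega) (by omega)]; omega
  · refine ⟨[n - 1], by simp, by simpa using ⟨by omega, hp n (by omega) (by omega)⟩, ?_⟩
    simp [hwgt n h1, hw2 (n - 1) (by omega) (by omega)]

/-- No extended Dynkin diagram of type `E₆` in a positive graph. -/
theorem IsPositive.not_extended_e6 [Fintype V] (hG : G.IsPositive) {x : ℕ → V} {l v : V}
    {m k : ℕ} (h : G.IsBranchedSeq x l m k) (hxv : ∀ i < m, x i ≠ v) (hlv : G.Adj l v)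
    (hk : 2 ≤ k) (hkm : k + 2 < m) : False := by
  have hx : ∀ n < m, attach (attach x m l) (m + 1) v n = x n := fun n hn => by
    rw [attach_of_lt (by omega), attach_of_lt hn]
  have hl : attach (attach x m l) (m + 1) v m = l := by
    rw [attach_of_lt (by omega), attach_self]
  have hv : attach (attach x m l) (m + 1) v (m + 1) = v := attach_self
  have hinj : Set.InjOn (attach (attach x m l) (m + 1) v) (Set.Iio (m + 1 + 1)) :=
    injOn_attach (injOn_attach h.injOn h.ne) fun i hi => by
      rcases Nat.lt_succ_iff_lt_or_eq.1 hi with hi | rfl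
      · rw [attach_of_lt hi]; exact hxv i hi
      · rw [attach_self]; exact hlv.ne
  generalize attach (attach x m l) (m + 1) v = f at hx hl hv hinj
  have hs : ∀ n, n + 1 < m → G.Adj (f n) (f (n + 1)) := fun n hn => by
    rw [hx n (by omega), hx _ hn]; exact h.adj n hn
  have hkl : G.Adj (f k) (f m) := by rw [hx k (by omega), hl]; exact h.adj_leaf
  have hlv' : G.Adj (f m) (f (m + 1)) := by rwa [hl, hv]
  obtain ⟨k, rfl⟩ := Nat.exists_eq_add_of_le' hk
  -- The branch vertex now has index `k + 2`. Weights `1 2 3 2 1` along the path, then `2` at `l`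
  -- and `1` at `v`.
  let w : ℕ → ℕ := fun n =>
    if n = m then 2 else if n = m + 1 then 1 else 3 - (n - (k + 2)) - (k + 2 - n)
  have key := hG.weight_eq_zero {k, k + 1, k + 2, k + 3, k + 4, m, m + 1}
    (hinj.mono fun n hn => by
      simp only [Finset.coe_insert, Finset.coe_singleton, Set.mem_insert_iff,
        Set.mem_singleton_iff] at hn
      simp only [Set.mem_Iio]; omega) w (fun n hn => ?_) m (by simp)
  · simp [w] at key
  have hwm : w m = 2 := by simp [w]
  have hwm1 : w (m + 1) = 1 := by simp [w]
  have hw : ∀ n, n < m → w n = 3 - (n - (k + 2)) - (k + 2 - n) := fun n hn => by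
    simp only [w]; rw [if_neg (by omega), if_neg (by omega)]
  have hw0 : w k = 1 := by rw [hw k (by omega)]; omega
  have hw1 : w (k + 1) = 2 := by rw [hw _ (by omega)]; omega
  have hw2 : w (k + 2) = 3 := by rw [hw _ (by omega)]; omega
  have hw3 : w (k + 3) = 2 := by rw [hw _ (by omega)]; omega
  have hw4 : w (k + 4) = 1 := by rw [hw _ (by omega)]; omega
  simp only [Finset.mem_insert, Finset.mem_singleton] at hn
  rcases hn with rfl | rfl | rfl | rfl | rfl | rfl | rfl
  · exact ⟨[n + 1], by simp, by simpa using hs n (by omega), by simp [*]⟩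
  · exact ⟨[k, k + 2], by simp, by simpa using ⟨(hs k (by omega)).symm, hs (k + 1) (by omega)⟩,
      by simp [*]⟩
  · exact ⟨[k + 1, k + 3, m], by simp; omega,
      by simpa using ⟨(hs (k + 1) (by omega)).symm, hs (k + 2) (by omega), hkl⟩, by simp [*]⟩
  · exact ⟨[k + 2, k + 4], by simp,
      by simpa using ⟨(hs (k + 2) (by omega)).symm, hs (k + 3) (by omega)⟩, by simp [*]⟩
  · exact ⟨[k + 3], by simp, by simpa using (hs (k + 3) (by omega)).symm, by simp [*]⟩
  · exact ⟨[k + 2, n + 1], by simp; omega, by simpa using ⟨hkl.symm, hlv'⟩, by simp [*]⟩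
  · exact ⟨[m], by simp, by simpa using hlv'.symm, by simp [*]⟩

/-- No extended Dynkin diagram of type `E₇` in a positive graph. -/
theorem IsPositive.not_extended_e7 [Fintype V] (hG : G.IsPositive) {x : ℕ → V} {l : V}
    {m k : ℕ} (h : G.IsBranchedSeq x l m k) (hk : 3 ≤ k) (hkm : k + 3 < m) : False := by
  have hx : ∀ n < m, attach x m l n = x n := fun n hn => attach_of_lt hn
  have hl : attach x m l m = l := attach_self
  have hinj := injOn_attach h.injOn h.ne
  generalize attach x m l = f at hx hl hinj
  have hs : ∀ n, n + 1 < m → G.Adj (f n) (f (n + 1)) := fun n hn => by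
    rw [hx n (by omega), hx _ hn]; exact h.adj n hn
  have hkl : G.Adj (f k) (f m) := by rw [hx k (by omega), hl]; exact h.adj_leaf
  obtain ⟨k, rfl⟩ := Nat.exists_eq_add_of_le' hk
  -- Weights `1 2 3 4 3 2 1` along the path and `2` at `l`.
  let w : ℕ → ℕ := fun n => if n = m then 2 else 4 - (n - (k + 3)) - (k + 3 - n)
  have key := hG.weight_eq_zero {k, k + 1, k + 2, k + 3, k + 4, k + 5, k + 6, m}
    (hinj.mono fun n hn => by
      simp only [Finset.coe_insert, Finset.coe_singleton, Set.mem_insert_iff,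
        Set.mem_singleton_iff] at hn
      simp only [Set.mem_Iio]; omega) w (fun n hn => ?_) m (by simp)
  · simp [w] at key
  have hwm : w m = 2 := by simp [w]
  have hw : ∀ n, n < m → w n = 4 - (n - (k + 3)) - (k + 3 - n) := fun n hn => if_neg (by omega)
  have hw0 : w k = 1 := by rw [hw k (by omega)]; omega
  have hw1 : w (k + 1) = 2 := by rw [hw _ (by omega)]; omega
  have hw2 : w (k + 2) = 3 := by rw [hw _ (by omega)]; omega
  have hw3 : w (k + 3) = 4 := by rw [hw _ (by omega)]; omega
  have hw4 : w (k + 4) = 3 := by rw [hw _ (by omega)]; omega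
  have hw5 : w (k + 5) = 2 := by rw [hw _ (by omega)]; omega
  have hw6 : w (k + 6) = 1 := by rw [hw _ (by omega)]; omega
  simp only [Finset.mem_insert, Finset.mem_singleton] at hn
  rcases hn with rfl | rfl | rfl | rfl | rfl | rfl | rfl | rfl
  · exact ⟨[n + 1], by simp, by simpa using hs n (by omega), by simp [*]⟩
  · exact ⟨[k, k + 2], by simp, by simpa using ⟨(hs k (by omega)).symm, hs (k + 1) (by omega)⟩,
      by simp [*]⟩
  · exact ⟨[k + 1, k + 3], by simp,
      by simpa using ⟨(hs (k + 1) (by omega)).symm, hs (k + 2) (by omega)⟩, by simp [*]⟩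
  · exact ⟨[k + 2, k + 4, m], by simp; omega,
      by simpa using ⟨(hs (k + 2) (by omega)).symm, hs (k + 3) (by omega), hkl⟩, by simp [*]⟩
  · exact ⟨[k + 3, k + 5], by simp,
      by simpa using ⟨(hs (k + 3) (by omega)).symm, hs (k + 4) (by omega)⟩, by simp [*]⟩
  · exact ⟨[k + 4, k + 6], by simp,
      by simpa using ⟨(hs (k + 4) (by omega)).symm, hs (k + 5) (by omega)⟩, by simp [*]⟩
  · exact ⟨[k + 5], by simp, by simpa using (hs (k + 5) (by omega)).symm, by simp [*]⟩
  · exact ⟨[k + 3], by simp, by simpa using hkl.symm, by simp [*]⟩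

/-- No extended Dynkin diagram of type `E₈` in a positive graph. -/
theorem IsPositive.not_extended_e8 [Fintype V] (hG : G.IsPositive) {x : ℕ → V} {l : V}
    {m : ℕ} (h : G.IsBranchedSeq x l m 2) (hm : 7 < m) : False := by
  have hx : ∀ n < m, attach x m l n = x n := fun n hn => attach_of_lt hn
  have hl : attach x m l m = l := attach_self
  have hinj := injOn_attach h.injOn h.ne
  generalize attach x m l = f at hx hl hinj
  have hs : ∀ n, n + 1 < m → G.Adj (f n) (f (n + 1)) := fun n hn => by
    rw [hx n (by omega), hx _ hn]; exact h.adj n hn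
  have hkl : G.Adj (f 2) (f m) := by rw [hx 2 (by omega), hl]; exact h.adj_leaf
  -- Weights `2 4 6 5 4 3 2 1` along the path and `3` at `l`.
  let w : ℕ → ℕ := fun n => if n = m then 3 else if n ≤ 2 then 2 * n + 2 else 8 - n
  have key := hG.weight_eq_zero {0, 1, 2, 3, 4, 5, 6, 7, m}
    (hinj.mono fun n hn => by
      simp only [Finset.coe_insert, Finset.coe_singleton, Set.mem_insert_iff,
        Set.mem_singleton_iff] at hn
      simp only [Set.mem_Iio]; omega) w (fun n hn => ?_) m (by simp)
  · simp [w] at key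
  have hwm : w m = 3 := by simp [w]
  have hw : ∀ n, n < m → w n = if n ≤ 2 then 2 * n + 2 else 8 - n := fun n hn => if_neg (by omega)
  have hw0 : w 0 = 2 := hw 0 (by omega)
  have hw1 : w 1 = 4 := hw 1 (by omega)
  have hw2 : w 2 = 6 := hw 2 (by omega)
  have hw3 : w 3 = 5 := hw 3 (by omega)
  have hw4 : w 4 = 4 := hw 4 (by omega)
  have hw5 : w 5 = 3 := hw 5 (by omega)
  have hw6 : w 6 = 2 := hw 6 (by omega)
  have hw7 : w 7 = 1 := hw 7 (by omega)
  simp only [Finset.mem_insert, Finset.mem_singleton] at hn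
  rcases hn with rfl | rfl | rfl | rfl | rfl | rfl | rfl | rfl | rfl
  · exact ⟨[1], by simp, by simpa using hs 0 (by omega), by simp [*]⟩
  · exact ⟨[0, 2], by simp, by simpa using ⟨(hs 0 (by omega)).symm, hs 1 (by omega)⟩, by simp [*]⟩
  · exact ⟨[1, 3, m], by simp; omega,
      by simpa using ⟨(hs 1 (by omega)).symm, hs 2 (by omega), hkl⟩, by simp [*]⟩
  · exact ⟨[2, 4], by simp, by simpa using ⟨(hs 2 (by omega)).symm, hs 3 (by omega)⟩, by simp [*]⟩
  · exact ⟨[3, 5], by simp, by simpa using ⟨(hs 3 (by omega)).symm, hs 4 (by omega)⟩, by simp [*]⟩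
  · exact ⟨[4, 6], by simp, by simpa using ⟨(hs 4 (by omega)).symm, hs 5 (by omega)⟩, by simp [*]⟩
  · exact ⟨[5, 7], by simp, by simpa using ⟨(hs 5 (by omega)).symm, hs 6 (by omega)⟩, by simp [*]⟩
  · exact ⟨[6], by simp, by simpa using (hs 6 (by omega)).symm, by simp [*]⟩
  · exact ⟨[2], by simp, by simpa using hkl.symm, by simp [*]⟩

end SimpleGraph

/-! ### Classification of connected positive graphs. -/

namespace SimpleGraph

variable {V : Type*} {G : SimpleGraph V}

theorem Preconnected.exists_adj_of_ne_univ (hG : G.Preconnected) {S : Set V} {u v : V}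
    (hu : u ∈ S) (hv : v ∉ S) : ∃ a ∈ S, ∃ b, b ∉ S ∧ G.Adj a b := by
  obtain ⟨p⟩ := hG u v
  obtain ⟨d, -, h1, h2⟩ := p.exists_boundary_dart S hu hv
  exact ⟨d.fst, h1, d.snd, h2, d.adj⟩

theorem exists_nat_maximal {p : ℕ → Prop} {N : ℕ} (hp : ∃ m, p m) (hN : ∀ m, p m → m ≤ N) :
    ∃ m, p m ∧ ∀ m', p m' → m' ≤ m := by
  classical
  obtain ⟨m, hm⟩ := hp
  exact ⟨Nat.findGreatest p N, Nat.findGreatest_spec (hN m hm) hm,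
    fun m' h => Nat.le_findGreatest (hN m' h) h⟩

/-- In a connected graph, either some path visits all vertices or some vertex outside a path is
adjacent to one of its interior vertices. -/
theorem Connected.exists_isPathSeq_or_isBranchedSeq [Fintype V] (hG : G.Connected) :
    (∃ x m, 1 ≤ m ∧ G.IsPathSeq x m ∧ ∀ v, ∃ i < m, x i = v) ∨
      ∃ x l m k, G.IsBranchedSeq x l m k := by
  obtain ⟨v₀⟩ := hG.nonempty
  obtain ⟨m, ⟨x, hx⟩, hmax⟩ := exists_nat_maximal (p := fun m => ∃ x, G.IsPathSeq x m)
    ⟨1, fun _ => v₀, fun a ha b hb _ => by simp only [Set.mem_Iio] at ha hb; omega,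
      fun i hi => by omega⟩ (fun m ⟨x, hx⟩ => hx.le_card)
  have hm : 1 ≤ m := hmax 1 ⟨fun _ => v₀, fun a ha b hb _ => by
    simp only [Set.mem_Iio] at ha hb; omega, fun i hi => by omega⟩
  by_cases hcov : ∀ v, ∃ i < m, x i = v
  · exact Or.inl ⟨x, m, hm, hx, hcov⟩
  push Not at hcov
  obtain ⟨v, hv⟩ := hcov
  obtain ⟨_, ⟨k, hk, rfl⟩, b, hb, hadj⟩ := hG.preconnected.exists_adj_of_ne_univ
    (S := x '' Set.Iio m) ⟨0, hm, rfl⟩ (v := v) (by rintro ⟨i, hi, h⟩; exact hv i hi h)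
  have hb' : ∀ i < m, x i ≠ b := fun i hi e => hb ⟨i, hi, e⟩
  simp only [Set.mem_Iio] at hk
  right
  -- The path is longest possible, so `b` cannot be adjacent to either end.
  refine ⟨x, b, m, k, hx, hb', hadj, ?_, ?_⟩
  · by_contra h0
    obtain rfl : k = 0 := by omega
    have := hmax _ ⟨_, hx.cons hb' hadj.symm⟩
    omega
  · by_contra h0
    obtain rfl : k = m - 1 := by omega
    have := hmax _ ⟨_, hx.reverse.cons (fun i hi => hb' _ (by omega)) hadj.symm⟩
    omega

/-- In a connected positive graph, a path with one more vertex attached to its interior, of maximal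
length, contains all the vertices. -/
theorem IsPositive.exists_spanning_isBranchedSeq [Fintype V] (hG : G.IsPositive)
    (hc : G.Connected) (hex : ∃ x l m k, G.IsBranchedSeq x l m k) :
    ∃ x l m k, G.IsBranchedSeq x l m k ∧ ∀ v, v = l ∨ ∃ i < m, x i = v := by
  obtain ⟨m, ⟨x, l, k, hx⟩, hmax⟩ :=
    exists_nat_maximal (p := fun m => ∃ x l k, G.IsBranchedSeq x l m k)
      (by obtain ⟨x, l, m, k, h⟩ := hex; exact ⟨m, x, l, k, h⟩)
      (fun m ⟨x, l, k, hx⟩ => hx.toIsPathSeq.le_card)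
  have hlt := hx.lt
  refine ⟨x, l, m, k, hx, ?_⟩
  by_contra hcov
  push Not at hcov
  obtain ⟨v, hvl, hv⟩ := hcov
  obtain ⟨a, ha, b, hb, hadj⟩ := hc.preconnected.exists_adj_of_ne_univ
    (S := insert l (x '' Set.Iio m)) (Set.mem_insert _ _) (v := v) (by
      rintro (h | ⟨i, hi, h⟩)
      · exact hvl h
      · exact hv i hi h)
  have hb' : ∀ i < m, x i ≠ b := fun i hi e => hb (Or.inr ⟨i, hi, e⟩)
  have hbl : b ≠ l := fun e => hb (Or.inl e)
  -- A neighbour of the leaf gives an exchange to a longer path if an arm of the path has length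
  -- `1`, and an extended `E₆` otherwise. A neighbour of an interior vertex gives an extended `D`,
  -- and one of an end lengthens the path.
  rcases ha with rfl | ⟨j, hj, rfl⟩
  · rcases Nat.lt_or_ge k 2 with hk | hk
    · obtain rfl : k = 1 := by have := hx.one_le; omega
      obtain ⟨y, hy⟩ := hx.exchange hb' hadj.symm
      have := hmax _ ⟨_, _, _, hy⟩
      omega
    · rcases Nat.lt_or_ge (k + 2) m with hkm | hkm
      · exact hG.not_extended_e6 hx hb' hadj hk hkm
      · have hr := hx.reverse
        rw [show m - 1 - k = 1 by omega] at hr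
        obtain ⟨y, hy⟩ := hr.exchange (fun i hi => hb' _ (by omega)) hadj.symm
        have := hmax _ ⟨_, _, _, hy⟩
        omega
  · simp only [Set.mem_Iio] at hj
    rcases Nat.eq_zero_or_pos j with rfl | hj0
    · have := hmax _ ⟨_, _, _, hx.cons hb' hbl hadj.symm⟩
      omega
    rcases Nat.lt_or_ge (j + 1) m with hjm | hjm
    · have hy : G.IsBranchedSeq x b m j := ⟨hx.toIsPathSeq, hb', hadj, hj0, hjm⟩
      rcases le_total k j with h | h
      · exact hG.not_two_branches hx hy hbl h
      · exact hG.not_two_branches hy hx hbl.symm h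
    · obtain rfl : j = m - 1 := by omega
      have := hmax _ ⟨_, _, _, hx.reverse.cons (fun i hi => hb' _ (by omega)) hbl hadj.symm⟩
      omega

theorem IsPathSeq.nonempty_iso {x : ℕ → V} {m : ℕ} (hG : G.IsAcyclic) (h : G.IsPathSeq x m)
    (hcov : ∀ v, ∃ i < m, x i = v) : Nonempty (G ≃g graphA m) := by
  refine hG.nonempty_iso_of_bijective (pathGraph_preconnected m)
    ⟨fun i : Fin m => x i, fun {a b} hab => ?_⟩ ⟨fun a b hab => ?_, fun v => ?_⟩
  · rw [graphA, pathGraph_adj] at hab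
    rcases hab with e | e
    · rw [← e]; exact h.adj _ (by omega)
    · rw [← e]; exact (h.adj _ (by omega)).symm
  · exact Fin.ext (h.injOn a.2 b.2 hab)
  · obtain ⟨i, hi, rfl⟩ := hcov v
    exact ⟨⟨i, hi⟩, rfl⟩

theorem IsBranchedSeq.nonempty_iso {x : ℕ → V} {l : V} {m k : ℕ} (hG : G.IsAcyclic)
    (h : G.IsBranchedSeq x l m k) (hcov : ∀ v, v = l ∨ ∃ i < m, x i = v) :
    Nonempty (G ≃g branchedPath (m + 1) k) := by
  have hlt := h.lt
  have hadj : ∀ a b : Fin (m + 1), ((a : ℕ) + 1 = b ∧ (b : ℕ) + 1 < m + 1) ∨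
      ((a : ℕ) = k ∧ (b : ℕ) + 1 = m + 1) → G.Adj (attach x m l a) (attach x m l b) := by
    rintro a b (⟨h1, h2⟩ | ⟨h1, h2⟩)
    · rw [attach_of_lt (by omega), attach_of_lt (by omega), ← h1]
      exact h.adj _ (by omega)
    · rw [attach_of_lt (by omega), h1, show (b : ℕ) = m by omega, attach_self]
      exact h.adj_leaf
  refine hG.nonempty_iso_of_bijective (branchedPath_preconnected (by omega))
    ⟨fun i : Fin (m + 1) => attach x m l i, fun {a b} hab => ?_⟩ ⟨fun a b hab => ?_, fun v => ?_⟩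
  · rw [branchedPath, fromRel_adj] at hab
    rcases hab.2 with e | e
    · exact hadj a b e
    · exact (hadj b a e).symm
  · exact Fin.ext (injOn_attach h.injOn h.ne a.2 b.2 hab)
  · obtain rfl | ⟨i, hi, rfl⟩ := hcov v
    · exact ⟨Fin.last m, attach_self⟩
    · exact ⟨⟨i, by omega⟩, attach_of_lt hi⟩

theorem IsPositive.isADE_of_isBranchedSeq [Fintype V] (hG : G.IsPositive) {x : ℕ → V} {l : V}
    {m k : ℕ} (h : G.IsBranchedSeq x l m k) (hcov : ∀ v, v = l ∨ ∃ i < m, x i = v) :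
    G.IsADE := by
  have h1 := h.one_le
  have hlt := h.lt
  -- By reversal, the arm of length `k` is no longer than the other, of length `m - 1 - k`.
  wlog hk : 2 * k + 1 ≤ m generalizing x k
  · refine this h.reverse (fun v => (hcov v).imp_right ?_) (by omega) (by omega) (by omega)
    rintro ⟨i, hi, rfl⟩
    exact ⟨m - 1 - i, by omega, by rw [show m - 1 - (m - 1 - i) = i by omega]⟩
  obtain rfl | rfl | hk3 : k = 1 ∨ k = 2 ∨ 3 ≤ k := by omega
  · refine Or.inr (Or.inl ⟨m + 1, by omega, ?_⟩)
    -- `graphD` has its branch vertex next to the far end of the path, hence the reversal.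
    have := h.reverse.nonempty_iso hG.isAcyclic (fun v => (hcov v).imp_right ?_)
    · rw [graphD, show m + 1 - 3 = m - 1 - 1 by omega]
      exact this
    rintro ⟨i, hi, rfl⟩
    exact ⟨m - 1 - i, by omega, by rw [show m - 1 - (m - 1 - i) = i by omega]⟩
  · refine Or.inr (Or.inr ⟨m + 1, ?_, h.nonempty_iso hG.isAcyclic hcov⟩)
    -- With `k = 2` the long arm gives `5 ≤ m`, so `m + 1` is `6`, `7` or `8`.
    have : ¬ 7 < m := fun hm => hG.not_extended_e8 h hm
    omega
  · exact (hG.not_extended_e7 h hk3 (by omega)).elim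

/-- A connected positive graph is a connected simply laced Dynkin diagram. -/
theorem IsPositive.isADE [Fintype V] (hG : G.IsPositive) (hc : G.Connected) : G.IsADE := by
  rcases hc.exists_isPathSeq_or_isBranchedSeq with ⟨x, m, hm, hx, hcov⟩ | h
  · exact Or.inl ⟨m, hm, hx.nonempty_iso hG.isAcyclic hcov⟩
  · obtain ⟨x, l, m, k, hx, hcov⟩ := hG.exists_spanning_isBranchedSeq hc h
    exact hG.isADE_of_isBranchedSeq hx hcov

theorem IsPositive.isDynkinDiagram [Fintype V] (hG : G.IsPositive) : G.IsDynkinDiagram := by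
  classical
  refine ⟨inferInstance, fun c => ?_⟩
  have := Fintype.ofFinite c
  exact IsPositive.isADE (hG.of_hom c.toSimpleGraph_hom Subtype.val_injective)
    c.connected_toSimpleGraph

end SimpleGraph

theorem corollary2p2 {V : Type*} :
    (∀ (C : SimpleGraph V) (Q : MixedGraph V),
      C.IsDynkinDiagram → Q.IsOrientationOf C → Finite Q.HeckeKiselman) ∧
    (∀ Q : MixedGraph V, Finite Q.HeckeKiselman → Q.edges.IsDynkinDiagram) := by
  refine ⟨fun C Q hC hQ => MixedGraph.finite_of_isOrientationOf hC hQ, fun Q hQ => ?_⟩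
  have := Q.finite_vertices
  cases nonempty_fintype V
  exact Q.isPositive_edges.isDynkinDiagram
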